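/- Let $\Omega\subset\mathbb{R}^3$ be a bounded convex domain (non-empty and open; no smoothness of the boundary is assumed). Let $\{\mathcal{T}_h\}$ be a family of finite conforming tetrahedral meshes with mesh sizes $0<h<1$, where $\mathcal{T}_h$ triangulates a computational domain $\Omega_h\subset\Omega$ (the interior of the union of the closed tetrahedra of $\mathcal{T}_h$). Assume that the family is shape regular and quasi-uniform: there are constants $\gamma,c_1,c_2>0$ such that for every $h$ each tetrahedron $\tau\in\mathcal{T}_h$ contains a ball of radius $\gamma\operatorname{diam}\tau$ and satisfies $c_1h\le\operatorname{diam}\tau\le c_2h$. Let $V_h^0$ be the space of continuous functions on $\overline{\Omega_h}$ that are affine on each tetrahedron of $\mathcal{T}_h$ and vanish on $\partial\Omega_h$, extended by zero outside $\Omega_h$. Then for every $h$ and every $z\in\Omega$ there is exactly one function $G_h^z\in V_h^0$ (the discrete Green's function with singularity at $z$) with $$\int_\Omega\nabla G_h^z\cdot\nabla v_h\,dx=v_h(z)\qquad\text{for all }v_h\in V_h^0,$$ and there is a constant $C>0$, independent of $h$ and $z$, such that for every $h$ and every $z\in\Omega$ $$G_h^z(z)\le C\,h^{-1}.$$ -/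

import Mathlib

/-- Euclidean three-space. -/
abbrev E3 : Type := EuclideanSpace ℝ (Fin 3)

/-- A finite conforming tetrahedral mesh in `ℝ³`. A tetrahedron is given by its set of four affinely
independent vertices; any two tetrahedra of the mesh meet in the convex hull of their common
vertices, that is, in a common face of dimension at most 2 or not at all, unless they are equal. -/
structure Triangulation where
  /-- the tetrahedra (as vertex sets) -/
  cells : Finset (Finset E3)
  card_eq : ∀ τ ∈ cells, τ.card = 4
  affineIndependent : ∀ τ ∈ cells, AffineIndependent ℝ (fun p : τ => (p : E3))
  conforming : ∀ τ₁ ∈ cells, ∀ τ₂ ∈ cells,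
    convexHull ℝ (τ₁ : Set E3) ∩ convexHull ℝ (τ₂ : Set E3) =
      convexHull ℝ ((τ₁ : Set E3) ∩ (τ₂ : Set E3))

namespace Triangulation

/-- The (open) computational domain `Ω_h` of a mesh: the interior of the union of its closed
tetrahedra. -/
def domain (T : Triangulation) : Set E3 :=
  interior (⋃ τ ∈ T.cells, convexHull ℝ (τ : Set E3))

/-- The space `V_h⁰(Ω_h)` of continuous functions that are affine on each tetrahedron of the mesh and
vanish on `∂Ω_h`. As usual its elements are extended by zero to the whole space; a function on the
closure of `Ω_h` that vanishes on `∂Ω_h` is continuous if and only if this extension is. -/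
def Vh0 (T : Triangulation) : Submodule ℝ (E3 → ℝ) where
  carrier := {v | Continuous v ∧
    (∀ τ ∈ T.cells, ∃ a : E3 →ᵃ[ℝ] ℝ, Set.EqOn v a (convexHull ℝ (τ : Set E3))) ∧
    ∀ x, x ∉ T.domain → v x = 0}
  zero_mem' := ⟨continuous_const, fun _ _ => ⟨0, fun _ _ => rfl⟩, fun _ _ => rfl⟩
  add_mem' := by
    rintro v w ⟨hv, hv', hv0⟩ ⟨hw, hw', hw0⟩
    refine ⟨hv.add hw, fun τ hτ => ?_, fun x hx => by simp [hv0 x hx, hw0 x hx]⟩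
    obtain ⟨a, ha⟩ := hv' τ hτ
    obtain ⟨b, hb⟩ := hw' τ hτ
    exact ⟨a + b, fun x hx => by simp [ha hx, hb hx]⟩
  smul_mem' := by
    rintro c v ⟨hv, hv', hv0⟩
    refine ⟨hv.const_smul c, fun τ hτ => ?_, fun x hx => by simp [hv0 x hx]⟩
    obtain ⟨a, ha⟩ := hv' τ hτ
    exact ⟨c • a, fun x hx => by simp [ha hx]⟩

end Triangulation

/-- `(∇u, ∇v)_Ω`, the `L²(Ω)` inner product of the gradients. A function in `V_h⁰` is differentiable
off the faces of the tetrahedra, a null set, and there its classical gradient is its weak gradient. -/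
noncomputable def gradInner (Ω : Set E3) (u v : E3 → ℝ) : ℝ :=
  ∫ x in Ω, inner ℝ (gradient u x) (gradient v x)

/-- `G` is a discrete Green's function with singularity at `z`:
`G ∈ V_h⁰` and `(∇G, ∇v)_Ω = v(z)` for all `v ∈ V_h⁰`. -/
def IsDiscreteGreen (Ω : Set E3) (T : Triangulation) (z : E3) (G : E3 → ℝ) : Prop :=
  G ∈ T.Vh0 ∧ ∀ v ∈ T.Vh0, gradInner Ω G v = v z

/-- The family of meshes is shape regular: for some `γ > 0`, every tetrahedron `τ` of every mesh
contains a ball of radius `γ diam τ`. -/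
def ShapeRegular {ι : Type*} (T : ι → Triangulation) : Prop :=
  ∃ γ : ℝ, 0 < γ ∧ ∀ i, ∀ τ ∈ (T i).cells, ∃ c : E3,
    Metric.closedBall c (γ * Metric.diam (convexHull ℝ (τ : Set E3))) ⊆ convexHull ℝ (τ : Set E3)

/-- The family of meshes is quasi-uniform of mesh size `h`: the diameters of the tetrahedra of the
`i`-th mesh are comparable to `h i`, uniformly in `i`. -/
def QuasiUniform {ι : Type*} (T : ι → Triangulation) (h : ι → ℝ) : Prop :=
  ∃ c₁ c₂ : ℝ, 0 < c₁ ∧ 0 < c₂ ∧ ∀ i, ∀ τ ∈ (T i).cells,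
    c₁ * h i ≤ Metric.diam (convexHull ℝ (τ : Set E3)) ∧
      Metric.diam (convexHull ℝ (τ : Set E3)) ≤ c₂ * h i

open MeasureTheory Filter Topology Set
open scoped NNReal

/-! Everything rests on the discrete Sobolev inequality `exists_sq_apply_le_gradInner`. Tested with
`v = G`, the Green identity turns it into `G z ^ 2 ≤ C h⁻¹ G z`, and dividing gives the bound. The
inequality also makes the Dirichlet form definite on the finite-dimensional space `Vh0`, hence
existence and uniqueness.

For the Sobolev inequality, take the ball of radius `r ~ h` inside the cell containing `z`. The
average of `v` over `B(c, t)` tends to `0` as `t → ∞`, and by Cauchy–Schwarz its `t`-derivative is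
at most a multiple of `t ^ (-3/2) ‖∇v‖`. Integrating from `r` to `∞` bounds the average by `r ^
(-1/2) ‖∇v‖` (`LipschitzWith.integral_dilation_le`). On the cell `v` is affine, so its oscillation
there is controlled by the inverse estimate `Triangulation.norm_linear_sq_le`. -/

/-! ### Lipschitz bounds from closed pieces -/

/-- Just to the right of any point of a segment, one of the finitely many pieces recurs, and being
closed it contains the point itself. This bounds the lower right slope, which is all the mean value
inequality needs. -/
theorem LipschitzWith.of_finite_closed_cover {E ι : Type*} [NormedAddCommGroup E] [NormedSpace ℝ E]
    [Finite ι] {f : E → ℝ} {K : ℝ≥0} (hf : Continuous f) (s : ι → Set E)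
    (hs : ∀ i, IsClosed (s i)) (hcover : ∀ x, ∃ i, x ∈ s i)
    (hlip : ∀ i, LipschitzOnWith K f (s i)) : LipschitzWith K f := by
  refine LipschitzWith.of_dist_le_mul fun x y => ?_
  rw [dist_comm (f x), Real.dist_eq, ← Real.norm_eq_abs]
  set p : ℝ → E := fun t => AffineMap.lineMap x y t with hp
  have hpc : Continuous p := AffineMap.lineMap_continuous
  -- The comparison function must grow strictly faster than `K * dist x y`; the midpoint with `L`
  -- leaves room on both sides.
  refine le_of_forall_gt fun L hL => ?_
  have key := image_norm_le_of_liminf_right_slope_norm_lt_deriv_boundary (a := 0) (b := 1)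
    (f := fun t => f (p t) - f x) (f' := fun _ => K * dist x y)
    (B := fun t => ((K * dist x y + L) / 2) * t) (B' := fun _ => (K * dist x y + L) / 2)
    ((hf.comp hpc).sub continuous_const).continuousOn ?_ (by simp [hp])
    (by fun_prop) (fun t _ => by simpa using ((hasDerivAt_id t).const_mul _).hasDerivWithinAt)
    (fun t _ _ => by linarith) (x := 1) (by simp)
  · have hp1 : p 1 = y := AffineMap.lineMap_apply_one x y
    rw [hp1, mul_one] at key
    exact key.trans_lt (by linarith)
  intro t _ r hr
  obtain ⟨i, hi⟩ : ∃ i, ∃ᶠ z in 𝓝[>] t, p z ∈ s i := by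
    by_contra! hcon
    obtain ⟨z, hz⟩ := (eventually_all.2 hcon).exists
    obtain ⟨i, hi⟩ := hcover (p z)
    exact hz i hi
  have hti : p t ∈ s i := by
    have : t ∈ closure (p ⁻¹' s i) :=
      mem_closure_iff_frequently.2 (hi.filter_mono nhdsWithin_le_nhds)
    rwa [((hs i).preimage hpc).closure_eq] at this
  refine (hi.and_eventually self_mem_nhdsWithin).mono fun z ⟨hz, htz⟩ => lt_of_le_of_lt ?_ hr
  have htz : 0 < z - t := sub_pos.2 htz
  rw [slope_def_field, div_le_iff₀ htz]
  calc _ ≤ ‖(f (p z) - f x) - (f (p t) - f x)‖ := norm_sub_norm_le _ _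
    _ = dist (f (p z)) (f (p t)) := by rw [sub_sub_sub_cancel_right, dist_eq_norm]
    _ ≤ K * dist (p z) (p t) := (hlip i).dist_le_mul _ hz _ hti
    _ = K * dist x y * (z - t) := by
      rw [hp, dist_lineMap_lineMap, Real.dist_eq, abs_of_pos htz]; ring

/-! ### Averages over dilated balls -/

theorem LipschitzWith.ae_differentiableAt_comp_dilation {f : E3 → ℝ} {K : ℝ≥0}
    (hf : LipschitzWith K f) (c : E3) {t : ℝ} (ht : 0 < t) :
    ∀ᵐ y : E3, DifferentiableAt ℝ f (c + t • y) := by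
  have h : volume {x | ¬ DifferentiableAt ℝ f x} = 0 := hf.ae_differentiableAt (μ := volume)
  change volume ((t • ·) ⁻¹' ((c + ·) ⁻¹' {x | ¬ DifferentiableAt ℝ f x})) = 0
  rw [Measure.addHaar_preimage_smul _ ht.ne', measure_preimage_add, h, mul_zero]

theorem integral_comp_dilation (g : E3 → ℝ) (c : E3) {t : ℝ} (ht : 0 < t) :
    ∫ y, g (c + t • y) = (t ^ 3)⁻¹ * ∫ x, g x := by
  rw [Measure.integral_comp_smul volume (fun x => g (c + x)), integral_add_left_eq_self]
  simp [abs_of_pos ht]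

theorem MeasureTheory.Integrable.comp_dilation {g : E3 → ℝ} (hg : Integrable g) (c : E3) {t : ℝ}
    (ht : 0 < t) : Integrable fun y => g (c + t • y) :=
  (hg.comp_add_left c).comp_smul ht.ne'

/-- Rescaling to the unit ball fixes the domain of integration. Rademacher's theorem gives the
derivative of the integrand at `t` for almost every `y`, and `K` dominates the difference quotients.
-/
theorem LipschitzWith.hasDerivAt_integral_dilation {f : E3 → ℝ} {K : ℝ≥0} (hf : LipschitzWith K f)
    (c : E3) {t : ℝ} (ht : 0 < t) :
    HasDerivAt (fun t : ℝ => ∫ y in Metric.ball (0 : E3) 1, f (c + t • y))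
      (∫ y in Metric.ball (0 : E3) 1, fderiv ℝ f (c + t • y) y) t := by
  have hcont : ∀ t : ℝ, Continuous fun y : E3 => f (c + t • y) := fun t =>
    hf.continuous.comp (by fun_prop)
  have hfin : IsFiniteMeasure (volume.restrict (Metric.ball (0 : E3) 1)) :=
    ⟨by simp⟩
  refine (hasDerivAt_integral_of_dominated_loc_of_lip (s := univ) (bound := fun _ => (K : ℝ))
    univ_mem (Eventually.of_forall fun t => (hcont t).aestronglyMeasurable) ?_ ?_ ?_
    (integrable_const _) ?_).2
  · exact ((hcont t).continuousOn.integrableOn_compact (isCompact_closedBall (0 : E3) 1)).mono_set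
      Metric.ball_subset_closedBall
  · refine Measurable.aestronglyMeasurable ?_
    have h1 : Measurable fun y : E3 => fderiv ℝ f (c + t • y) :=
      (measurable_fderiv ℝ f).comp (by fun_prop)
    exact (isBoundedBilinearMap_apply (𝕜 := ℝ)).continuous.measurable.comp
      (h1.prodMk measurable_id)
  · refine (ae_restrict_mem measurableSet_ball).mono fun y hy => ?_
    refine LipschitzWith.lipschitzOnWith (LipschitzWith.of_dist_le_mul fun a b => ?_)
    refine (hf.dist_le_mul _ _).trans ?_
    simp only [Real.coe_nnabs, NNReal.abs_eq]
    refine mul_le_mul_of_nonneg_left ?_ K.2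
    rw [dist_add_left, dist_eq_norm, ← sub_smul, norm_smul, Real.dist_eq, Real.norm_eq_abs]
    exact mul_le_of_le_one_right (abs_nonneg _) (mem_ball_zero_iff.1 hy).le
  · refine ae_restrict_of_ae ((hf.ae_differentiableAt_comp_dilation c ht).mono fun y hy => ?_)
    have h1 : HasDerivAt (fun t : ℝ => c + t • y) y t := by
      simpa using ((hasDerivAt_id t).smul_const y).const_add c
    exact hy.hasFDerivAt.comp_hasDerivAt t h1

theorem LipschitzWith.integrable_norm_fderiv_sq {f : E3 → ℝ} {K : ℝ≥0} (hf : LipschitzWith K f)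
    (hc : HasCompactSupport f) : Integrable fun x => ‖fderiv ℝ f x‖ ^ 2 := by
  refine IntegrableOn.integrable_of_forall_notMem_eq_zero (s := tsupport f) ?_ fun x hx => ?_
  · refine Measure.integrableOn_of_bounded (M := (K : ℝ) ^ 2) hc.measure_lt_top.ne
      ((measurable_fderiv ℝ f).norm.pow_const 2).aestronglyMeasurable
      (Eventually.of_forall fun x => ?_)
    rw [norm_pow, norm_norm]
    exact pow_le_pow_left₀ (norm_nonneg _) (norm_fderiv_le_of_lipschitz ℝ hf) 2
  · have : x ∉ tsupport (fderiv ℝ f) := fun h => hx (tsupport_fderiv_subset ℝ h)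
    simp [image_eq_zero_of_notMem_tsupport this]

theorem LipschitzWith.abs_deriv_integral_dilation_le {f : E3 → ℝ} {K : ℝ≥0}
    (hf : LipschitzWith K f) (hc : HasCompactSupport f) (c : E3) {t S : ℝ} (ht : 0 < t) (hS : 0 < S)
    (hfS : ∫ x, ‖fderiv ℝ f x‖ ^ 2 ≤ S ^ 2) :
    |∫ y in Metric.ball (0 : E3) 1, fderiv ℝ f (c + t • y) y| ≤
      (volume.real (Metric.ball (0 : E3) 1) + 1) / 2 * S * t ^ (-(3 / 2) : ℝ) := by
  set B := Metric.ball (0 : E3) 1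
  -- Cauchy–Schwarz is replaced by `a ≤ l / 2 + a ^ 2 / (2 * l)`; this `l` satisfies `l ^ 2 = t⁻³ S
  -- ^ 2`, the bound for the rescaled energy.
  set l : ℝ := S * t ^ (-(3 / 2) : ℝ) with hl
  have hlpos : 0 < l := by positivity
  have hl2 : (t ^ 3)⁻¹ * S ^ 2 = l ^ 2 := by
    rw [hl, mul_pow, ← Real.rpow_natCast (t ^ (-(3 / 2) : ℝ)), ← Real.rpow_mul ht.le,
      ← Real.rpow_natCast t 3, ← Real.rpow_neg ht.le]
    norm_num
    ring
  have hi := (hf.integrable_norm_fderiv_sq hc).comp_dilation c ht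
  have hfin : IsFiniteMeasure (volume.restrict B) := ⟨by simp [B]⟩
  have hpt : ∀ y ∈ B, ‖fderiv ℝ f (c + t • y) y‖ ≤
      l / 2 + ‖fderiv ℝ f (c + t • y)‖ ^ 2 * (2 * l)⁻¹ := by
    intro y hy
    have h1 : ‖fderiv ℝ f (c + t • y) y‖ ≤ ‖fderiv ℝ f (c + t • y)‖ :=
      (ContinuousLinearMap.le_opNorm _ _).trans
        (mul_le_of_le_one_right (norm_nonneg _) (mem_ball_zero_iff.1 hy).le)
    refine h1.trans ?_
    set a := ‖fderiv ℝ f (c + t • y)‖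
    have : l / 2 + a ^ 2 * (2 * l)⁻¹ - a = (a - l) ^ 2 * (2 * l)⁻¹ := by field_simp; ring
    have : 0 ≤ (a - l) ^ 2 * (2 * l)⁻¹ := by positivity
    linarith
  rw [← Real.norm_eq_abs]
  calc _ ≤ ∫ y in B, (l / 2 + ‖fderiv ℝ f (c + t • y)‖ ^ 2 * (2 * l)⁻¹) :=
        norm_integral_le_of_norm_le ((integrable_const _).add (hi.integrableOn.mul_const _))
          ((ae_restrict_mem measurableSet_ball).mono hpt)
    _ = volume.real B * (l / 2) + (∫ y in B, ‖fderiv ℝ f (c + t • y)‖ ^ 2) * (2 * l)⁻¹ := by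
        rw [integral_add (integrable_const _) (hi.integrableOn.mul_const _), integral_mul_const]
        simp
    _ ≤ volume.real B * (l / 2) + l ^ 2 * (2 * l)⁻¹ := by
        gcongr
        refine (setIntegral_le_integral hi (Eventually.of_forall fun _ => by positivity)).trans ?_
        rw [integral_comp_dilation (fun x => ‖fderiv ℝ f x‖ ^ 2) c ht, ← hl2]
        gcongr
    _ = (volume.real B + 1) / 2 * S * t ^ (-(3 / 2) : ℝ) := by
        rw [mul_assoc, ← hl]; field_simp

theorem tendsto_integral_dilation_atTop {f : E3 → ℝ} (hf : Integrable f) (c : E3) :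
    Tendsto (fun t : ℝ => ∫ y in Metric.ball (0 : E3) 1, f (c + t • y)) atTop (𝓝 0) := by
  have h0 : Tendsto (fun t : ℝ => (t ^ 3)⁻¹ * ∫ x, ‖f x‖) atTop (𝓝 0) := by
    simpa using ((tendsto_pow_atTop (by norm_num : (3 : ℕ) ≠ 0)).inv_tendsto_atTop).mul_const
      (∫ x, ‖f x‖)
  refine squeeze_zero_norm' ((eventually_gt_atTop 0).mono fun t ht => ?_) h0
  refine (norm_integral_le_integral_norm _).trans ?_
  rw [← integral_comp_dilation (fun x => ‖f x‖) c ht]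
  exact setIntegral_le_integral (hf.norm.comp_dilation c ht)
    (Eventually.of_forall fun _ => norm_nonneg _)

/-- The mean over a ball of radius `r` of a compactly supported Lipschitz function is controlled by
`r ^ (-1/2)` times the `L²` norm of its gradient. -/
theorem LipschitzWith.integral_dilation_le {f : E3 → ℝ} {K : ℝ≥0}
    (hf : LipschitzWith K f) (hc : HasCompactSupport f) (c : E3) {r S : ℝ} (hr : 0 < r) (hS : 0 < S)
    (hfS : ∫ x, ‖fderiv ℝ f x‖ ^ 2 ≤ S ^ 2) :
    ∫ y in Metric.ball (0 : E3) 1, f (c + r • y) ≤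
      (volume.real (Metric.ball (0 : E3) 1) + 1) * S * r ^ (-(1 / 2) : ℝ) := by
  set b := volume.real (Metric.ball (0 : E3) 1) + 1
  set M : ℝ → ℝ := fun t => ∫ y in Metric.ball (0 : E3) 1, f (c + t • y) with hM
  have hderiv : ∀ t : ℝ, 0 < t → HasDerivAt (fun t => M t - b * S * t ^ (-(1 / 2) : ℝ))
      ((∫ y in Metric.ball (0 : E3) 1, fderiv ℝ f (c + t • y) y) +
        b / 2 * S * t ^ (-(3 / 2) : ℝ)) t := by
    intro t ht
    have h1 := (hf.hasDerivAt_integral_dilation c ht).fun_sub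
      ((Real.hasDerivAt_rpow_const (p := -(1 / 2)) (Or.inl ht.ne')).const_mul (b * S))
    refine h1.congr_deriv ?_
    rw [show (-(1 / 2) - 1 : ℝ) = -(3 / 2) by norm_num]
    ring
  -- Monotone with limit `0` at infinity, this function is nonpositive at `r`; no integral in `t` is
  -- needed.
  have hmono : MonotoneOn (fun t => M t - b * S * t ^ (-(1 / 2) : ℝ)) (Ioi 0) := by
    refine monotoneOn_of_deriv_nonneg (convex_Ioi 0)
      (fun t ht => (hderiv t ht).continuousAt.continuousWithinAt) ?_ ?_
    all_goals
      intro t ht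
      rw [interior_Ioi] at ht
    · exact (hderiv t ht).differentiableAt.differentiableWithinAt
    · rw [(hderiv t ht).deriv]
      have := (abs_le.1 (hf.abs_deriv_integral_dilation_le hc c ht hS hfS)).1
      linarith
  have hlim : Tendsto (fun t => M t - b * S * t ^ (-(1 / 2) : ℝ)) atTop (𝓝 0) := by
    have h1 := tendsto_integral_dilation_atTop (hf.continuous.integrable_of_hasCompactSupport hc) c
    simpa using h1.sub ((tendsto_rpow_neg_atTop (by norm_num : (0 : ℝ) < 1 / 2)).const_mul (b * S))
  have := ge_of_tendsto hlim ((eventually_ge_atTop r).mono fun t ht =>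
    hmono hr (hr.trans_le ht) ht)
  simp only [hM] at this
  linarith

theorem LipschitzWith.abs_integral_dilation_le {f : E3 → ℝ} {K : ℝ≥0}
    (hf : LipschitzWith K f) (hc : HasCompactSupport f) (c : E3) {r S : ℝ} (hr : 0 < r) (hS : 0 < S)
    (hfS : ∫ x, ‖fderiv ℝ f x‖ ^ 2 ≤ S ^ 2) :
    |∫ y in Metric.ball (0 : E3) 1, f (c + r • y)| ≤
      (volume.real (Metric.ball (0 : E3) 1) + 1) * S * r ^ (-(1 / 2) : ℝ) := by
  refine abs_le'.2 ⟨hf.integral_dilation_le hc c hr hS hfS, ?_⟩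
  rw [← integral_neg]
  exact (hf.neg).integral_dilation_le (f := -f) hc.neg c hr hS (by simpa [fderiv_neg] using hfS)

/-! ### Finite element functions on a cell -/

theorem AffineMap.sub_eq_linear_toContinuousLinearMap (a : E3 →ᵃ[ℝ] ℝ) (x y : E3) :
    a x - a y = LinearMap.toContinuousLinearMap a.linear (x - y) := by
  simpa using (a.linearMap_vsub x y).symm

theorem AffineMap.hasFDerivAt_of_finiteDimensional (a : E3 →ᵃ[ℝ] ℝ) (x : E3) :
    HasFDerivAt a (LinearMap.toContinuousLinearMap a.linear) x := by
  have h : (a : E3 → ℝ) = fun y => LinearMap.toContinuousLinearMap a.linear y + a 0 := by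
    ext y
    rw [← sub_eq_iff_eq_add, a.sub_eq_linear_toContinuousLinearMap, sub_zero]
  rw [h]
  exact (ContinuousLinearMap.hasFDerivAt _).add_const _

namespace Triangulation

theorem isCompact_cell (τ : Finset E3) : IsCompact (convexHull ℝ (τ : Set E3)) :=
  τ.finite_toSet.isCompact_convexHull (𝕜 := ℝ)

theorem exists_mem_cell_of_mem_domain {T : Triangulation} {x : E3} (hx : x ∈ T.domain) :
    ∃ τ ∈ T.cells, x ∈ convexHull ℝ (τ : Set E3) := by
  simpa using interior_subset hx

theorem hasCompactSupport_of_mem_Vh0 {T : Triangulation} {v : E3 → ℝ} (hv : v ∈ T.Vh0) :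
    HasCompactSupport v := by
  refine HasCompactSupport.intro
    (T.cells.isCompact_biUnion fun τ _ => isCompact_cell τ) fun x hx => ?_
  exact hv.2.2 x fun h => hx (interior_subset h)

theorem exists_lipschitzWith_of_mem_Vh0 {T : Triangulation} {v : E3 → ℝ} (hv : v ∈ T.Vh0) :
    ∃ K, LipschitzWith K v := by
  choose! a ha using hv.2.1
  obtain ⟨K, hK⟩ :=
    (T.cells.image fun τ => ‖LinearMap.toContinuousLinearMap (a τ).linear‖₊).exists_le
  refine ⟨K, LipschitzWith.of_finite_closed_cover hv.1
    -- The index `none` adds the zero set of `v`, which covers the complement of the domain.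
    (fun i : Option T.cells => i.elim {x | v x = 0} fun τ => convexHull ℝ (τ : Set E3)) ?_ ?_ ?_⟩
  · rintro (_ | τ)
    · exact isClosed_eq hv.1 continuous_const
    · exact (isCompact_cell τ).isClosed
  · intro x
    by_cases hx : x ∈ T.domain
    · obtain ⟨τ, hτ, hxτ⟩ := exists_mem_cell_of_mem_domain hx
      exact ⟨some ⟨τ, hτ⟩, hxτ⟩
    · exact ⟨none, hv.2.2 x hx⟩
  · rintro (_ | ⟨τ, hτ⟩) <;> refine LipschitzOnWith.of_dist_le_mul fun x hx y hy => ?_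
    · have hx : v x = 0 := hx
      have hy : v y = 0 := hy
      rw [hx, hy, dist_self]
      positivity
    · rw [ha τ hτ hx, ha τ hτ hy, dist_eq_norm, dist_eq_norm,
        AffineMap.sub_eq_linear_toContinuousLinearMap]
      refine (ContinuousLinearMap.le_opNorm _ _).trans ?_
      gcongr
      exact hK _ (Finset.mem_image_of_mem _ hτ)

theorem volume_real_ball_zero_one_pos : 0 < volume.real (Metric.ball (0 : E3) 1) :=
  ENNReal.toReal_pos (Metric.measure_ball_pos _ _ one_pos).ne' measure_ball_lt_top.ne

/-- Inverse estimate on a cell containing a ball of radius `r`. -/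
theorem norm_linear_sq_le {v : E3 → ℝ} {K : ℝ≥0} (hv : LipschitzWith K v)
    (hc : HasCompactSupport v) {τ : Finset E3} {a : E3 →ᵃ[ℝ] ℝ}
    (ha : EqOn v a (convexHull ℝ (τ : Set E3))) {c : E3} {r : ℝ} (hr : 0 < r)
    (hball : Metric.closedBall c r ⊆ convexHull ℝ (τ : Set E3)) :
    ‖LinearMap.toContinuousLinearMap a.linear‖ ^ 2 *
      (r ^ 3 * volume.real (Metric.ball (0 : E3) 1)) ≤ ∫ x, ‖fderiv ℝ v x‖ ^ 2 := by
  have hfd : ∀ x ∈ Metric.ball c r, fderiv ℝ v x = LinearMap.toContinuousLinearMap a.linear := by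
    intro x hx
    have h1 : v =ᶠ[𝓝 x] a := (Metric.isOpen_ball.eventually_mem hx).mono fun y hy =>
      ha (hball (Metric.ball_subset_closedBall hy))
    rw [h1.fderiv_eq, (a.hasFDerivAt_of_finiteDimensional x).fderiv]
  have hvol : volume.real (Metric.ball c r) = r ^ 3 * volume.real (Metric.ball (0 : E3) 1) := by
    rw [measureReal_def, Measure.addHaar_ball_of_pos _ _ hr, ENNReal.toReal_mul,
      ENNReal.toReal_ofReal (by positivity), measureReal_def]
    simp
  calc _ = ∫ x in Metric.ball c r, ‖fderiv ℝ v x‖ ^ 2 := by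
        rw [setIntegral_congr_fun measurableSet_ball (fun x hx => by rw [hfd x hx])]
        rw [setIntegral_const, hvol, smul_eq_mul, mul_comm]
    _ ≤ _ := setIntegral_le_integral (hv.integrable_norm_fderiv_sq hc)
        (Eventually.of_forall fun _ => by positivity)

/-- Compare `v z` with the average over the inscribed ball: the first term comes from the average,
the second from the oscillation `‖A‖ * d` and the inverse estimate. -/
theorem sq_apply_le_of_mem_cell {v : E3 → ℝ} {K : ℝ≥0} (hv : LipschitzWith K v)
    (hc : HasCompactSupport v) {τ : Finset E3} {a : E3 →ᵃ[ℝ] ℝ}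
    (ha : EqOn v a (convexHull ℝ (τ : Set E3))) {c : E3} {r S : ℝ} (hr : 0 < r) (hS : 0 < S)
    (hball : Metric.closedBall c r ⊆ convexHull ℝ (τ : Set E3))
    (hvS : ∫ x, ‖fderiv ℝ v x‖ ^ 2 ≤ S ^ 2) {z : E3} (hz : z ∈ convexHull ℝ (τ : Set E3)) :
    (v z * volume.real (Metric.ball (0 : E3) 1)) ^ 2 ≤
      2 * S ^ 2 * ((volume.real (Metric.ball (0 : E3) 1) + 1) ^ 2 / r +
        volume.real (Metric.ball (0 : E3) 1) *
          Metric.diam (convexHull ℝ (τ : Set E3)) ^ 2 / r ^ 3) := by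
  set b := volume.real (Metric.ball (0 : E3) 1)
  have hb : 0 < b := volume_real_ball_zero_one_pos
  set A := LinearMap.toContinuousLinearMap a.linear
  set d := Metric.diam (convexHull ℝ (τ : Set E3))
  have hA : ‖A‖ ^ 2 * (r ^ 3 * b) ≤ S ^ 2 := (norm_linear_sq_le hv hc ha hr hball).trans hvS
  have hM := hv.abs_integral_dilation_le hc c hr hS hvS
  have hfin : IsFiniteMeasure (volume.restrict (Metric.ball (0 : E3) 1)) := ⟨by simp⟩
  have hosc : ∀ y ∈ Metric.ball (0 : E3) 1, ‖v z - v (c + r • y)‖ ≤ ‖A‖ * d := by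
    intro y hy
    have hmem : c + r • y ∈ convexHull ℝ (τ : Set E3) := by
      apply hball
      rw [mem_closedBall_iff_norm, add_sub_cancel_left, norm_smul, Real.norm_of_nonneg hr.le]
      exact mul_le_of_le_one_right hr.le (mem_ball_zero_iff.1 hy).le
    rw [ha hz, ha hmem, AffineMap.sub_eq_linear_toContinuousLinearMap]
    refine (A.le_opNorm _).trans ?_
    rw [← dist_eq_norm]
    gcongr
    exact Metric.dist_le_diam_of_mem (isCompact_cell τ).isBounded hz hmem
  have hint : IntegrableOn (fun y => v (c + r • y)) (Metric.ball (0 : E3) 1) :=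
    ((hv.continuous.integrable_of_hasCompactSupport hc).comp_dilation c hr).integrableOn
  have hdiff : |v z * b - ∫ y in Metric.ball (0 : E3) 1, v (c + r • y)| ≤ ‖A‖ * d * b := by
    have h1 := norm_setIntegral_le_of_norm_le_const (measure_ball_lt_top (μ := volume)) hosc
    rwa [integral_sub (integrable_const _) hint, setIntegral_const, smul_eq_mul, mul_comm b,
      Real.norm_eq_abs] at h1
  have habs : |v z * b| ≤ (b + 1) * S * r ^ (-(1 / 2) : ℝ) + ‖A‖ * d * b := by
    have := abs_add_le (v z * b - ∫ y in Metric.ball (0 : E3) 1, v (c + r • y))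
      (∫ y in Metric.ball (0 : E3) 1, v (c + r • y))
    rw [sub_add_cancel] at this
    linarith
  have hr2 : (r ^ (-(1 / 2) : ℝ)) ^ 2 = 1 / r := by
    rw [← Real.rpow_natCast, ← Real.rpow_mul hr.le]
    norm_num [Real.rpow_neg_one]
  have hA2 : (‖A‖ * d * b) ^ 2 ≤ S ^ 2 * (b * d ^ 2 / r ^ 3) := by
    calc (‖A‖ * d * b) ^ 2 = ‖A‖ ^ 2 * (r ^ 3 * b) * (b * d ^ 2 / r ^ 3) := by field_simp
      _ ≤ _ := by gcongr
  rw [← sq_abs]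
  calc |v z * b| ^ 2 ≤ ((b + 1) * S * r ^ (-(1 / 2) : ℝ) + ‖A‖ * d * b) ^ 2 := by gcongr
    _ ≤ 2 * (((b + 1) * S * r ^ (-(1 / 2) : ℝ)) ^ 2 + (‖A‖ * d * b) ^ 2) := add_sq_le
    _ ≤ 2 * ((b + 1) ^ 2 * S ^ 2 * (1 / r) + S ^ 2 * (b * d ^ 2 / r ^ 3)) := by
      rw [mul_pow, mul_pow, hr2]
      gcongr
    _ = _ := by ring

end Triangulation

/-! ### The Dirichlet form -/

theorem norm_gradient (f : E3 → ℝ) (x : E3) : ‖gradient f x‖ = ‖fderiv ℝ f x‖ :=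
  LinearIsometryEquiv.norm_map _ _

theorem measurable_gradient (f : E3 → ℝ) : Measurable (gradient f) :=
  (InnerProductSpace.toDual ℝ E3).symm.continuous.measurable.comp (measurable_fderiv ℝ f)

theorem LipschitzWith.integrableOn_inner_gradient {u v : E3 → ℝ} {K L : ℝ≥0}
    (hu : LipschitzWith K u) (hv : LipschitzWith L v) {Ω : Set E3} (hΩ : Bornology.IsBounded Ω) :
    IntegrableOn (fun x => inner ℝ (gradient u x) (gradient v x)) Ω := by
  refine Measure.integrableOn_of_bounded (M := K * L) hΩ.measure_lt_top.ne
    ((measurable_gradient u).inner (measurable_gradient v)).aestronglyMeasurable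
    (Eventually.of_forall fun x => (norm_inner_le_norm _ _).trans ?_)
  rw [norm_gradient, norm_gradient]
  gcongr
  · exact norm_fderiv_le_of_lipschitz ℝ hu
  · exact norm_fderiv_le_of_lipschitz ℝ hv

theorem gradInner_comm (Ω : Set E3) (u v : E3 → ℝ) : gradInner Ω u v = gradInner Ω v u := by
  simp only [gradInner, real_inner_comm]

theorem gradInner_smul_left (Ω : Set E3) (c : ℝ) (u v : E3 → ℝ) :
    gradInner Ω (c • u) v = c * gradInner Ω u v := by
  have h : ∀ x, gradient (c • u) x = c • gradient u x := fun x => by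
    simp [gradient, fderiv_const_smul_field]
  simp only [gradInner, h, inner_smul_left, integral_const_mul]
  rfl

theorem gradInner_add_left {u v w : E3 → ℝ} {K L M : ℝ≥0} (hu : LipschitzWith K u)
    (hv : LipschitzWith L v) (hw : LipschitzWith M w) {Ω : Set E3} (hΩ : Bornology.IsBounded Ω) :
    gradInner Ω (u + v) w = gradInner Ω u w + gradInner Ω v w := by
  rw [gradInner, gradInner, gradInner, ← integral_add (hu.integrableOn_inner_gradient hw hΩ)
    (hv.integrableOn_inner_gradient hw hΩ)]
  refine integral_congr_ae (ae_restrict_of_ae ?_)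
  filter_upwards [hu.ae_differentiableAt (μ := volume), hv.ae_differentiableAt (μ := volume)]
    with x hx hy
  simp only [gradient, fderiv_add hx hy, map_add, inner_add_left]

/-- The derivative vanishes off the closure of `Ω`, and convexity makes the frontier a null set.
Convexity enters the argument only here. -/
theorem gradInner_self_eq {Ω : Set E3} (hΩ : Convex ℝ Ω) {v : E3 → ℝ}
    (hv : ∀ x, x ∉ Ω → v x = 0) : gradInner Ω v v = ∫ x, ‖fderiv ℝ v x‖ ^ 2 := by
  simp only [gradInner, real_inner_self_eq_norm_sq, norm_gradient]
  refine setIntegral_eq_integral_of_ae_compl_eq_zero ?_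
  have h0 : ∀ᵐ x : E3, x ∉ frontier Ω :=
    measure_eq_zero_iff_ae_notMem.1 (hΩ.addHaar_frontier volume)
  filter_upwards [h0] with x hx hxΩ
  have hcl : x ∉ closure Ω := fun h => hx ⟨h, fun h' => hxΩ (interior_subset h')⟩
  have : v =ᶠ[𝓝 x] fun _ => 0 :=
    (isClosed_closure.isOpen_compl.eventually_mem hcl).mono fun y hy =>
      hv y fun h => hy (subset_closure h)
  simp [this.fderiv_eq]

/-! ### Existence and uniqueness of the discrete Green's function -/

namespace Triangulation

/-- Evaluation of finite element functions at the vertices of the mesh. -/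
def vertexEval (T : Triangulation) : T.Vh0 →ₗ[ℝ] (T.cells.biUnion id → ℝ) where
  toFun v p := (v : E3 → ℝ) p
  map_add' _ _ := rfl
  map_smul' _ _ := rfl

theorem vertexEval_injective (T : Triangulation) : Function.Injective T.vertexEval := by
  refine (injective_iff_map_eq_zero _).2 fun v hv => Subtype.ext (funext fun x => ?_)
  by_cases hx : x ∈ T.domain
  · obtain ⟨τ, hτ, hxτ⟩ := exists_mem_cell_of_mem_domain hx
    obtain ⟨a, ha⟩ := v.2.2.1 τ hτ
    have hsub : convexHull ℝ (τ : Set E3) ⊆ a ⁻¹' {0} := by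
      refine convexHull_min (fun p hp => ?_) ((convex_singleton (0 : ℝ)).affine_preimage a)
      have h1 : (v : E3 → ℝ) p = 0 :=
        congrFun hv ⟨p, Finset.mem_biUnion.2 ⟨τ, hτ, hp⟩⟩
      rwa [ha (subset_convexHull ℝ _ hp)] at h1
    exact (ha hxτ).trans (hsub hxτ)
  · exact v.2.2.2 x hx

instance finiteDimensional_Vh0 (T : Triangulation) : FiniteDimensional ℝ T.Vh0 :=
  FiniteDimensional.of_injective T.vertexEval T.vertexEval_injective

/-- The bilinear form `(∇u, ∇v)_Ω` on the finite element space. -/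
noncomputable def gradForm (T : Triangulation) {Ω : Set E3} (hΩ : Bornology.IsBounded Ω) :
    T.Vh0 →ₗ[ℝ] T.Vh0 →ₗ[ℝ] ℝ :=
  LinearMap.mk₂ ℝ (fun u v => gradInner Ω u v)
    (fun u v w => by
      obtain ⟨_, hu⟩ := exists_lipschitzWith_of_mem_Vh0 u.2
      obtain ⟨_, hv⟩ := exists_lipschitzWith_of_mem_Vh0 v.2
      obtain ⟨_, hw⟩ := exists_lipschitzWith_of_mem_Vh0 w.2
      exact gradInner_add_left hu hv hw hΩ)
    (fun c u v => gradInner_smul_left Ω c u v)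
    (fun u v w => by
      obtain ⟨_, hu⟩ := exists_lipschitzWith_of_mem_Vh0 u.2
      obtain ⟨_, hv⟩ := exists_lipschitzWith_of_mem_Vh0 v.2
      obtain ⟨_, hw⟩ := exists_lipschitzWith_of_mem_Vh0 w.2
      rw [gradInner_comm, gradInner_comm Ω u v, gradInner_comm Ω u w]
      exact gradInner_add_left hv hw hu hΩ)
    (fun c u v => by
      rw [gradInner_comm, gradInner_comm Ω u v]
      exact gradInner_smul_left Ω c v u)

/-- A definite form embeds `Vh0` into its dual; equality of dimensions makes this onto, so
evaluation at `z` is represented exactly once. -/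
theorem existsUnique_isDiscreteGreen (T : Triangulation) {Ω : Set E3}
    (hΩ : Bornology.IsBounded Ω) (hdef : ∀ v ∈ T.Vh0, gradInner Ω v v = 0 → v = 0) (z : E3) :
    ∃! G : E3 → ℝ, IsDiscreteGreen Ω T z G := by
  have hinj : Function.Injective (T.gradForm hΩ) := by
    refine (injective_iff_map_eq_zero _).2 fun v hv => Subtype.ext (hdef v v.2 ?_)
    exact LinearMap.congr_fun hv v
  have hsurj : Function.Surjective (T.gradForm hΩ) :=
    (LinearMap.injective_iff_surjective_of_finrank_eq_finrank
      (Subspace.dual_finrank_eq (K := ℝ) (V := T.Vh0)).symm).1 hinj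
  obtain ⟨G, hG⟩ := hsurj ((LinearMap.proj z).comp T.Vh0.subtype)
  refine ⟨G, ⟨G.2, fun v hv => LinearMap.congr_fun hG ⟨v, hv⟩⟩, fun G' hG' => ?_⟩
  have : T.gradForm hΩ ⟨G', hG'.1⟩ = T.gradForm hΩ G := by
    rw [hG]
    exact LinearMap.ext fun v => hG'.2 v v.2
  exact congrArg Subtype.val (hinj this)

end Triangulation

/-! ### Discrete Sobolev inequality and the final bound -/

/-- The discrete Sobolev inequality `‖v‖_∞ ≤ C h ^ (-1/2) ‖∇v‖_{L²}` for finite element functions on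
shape regular and quasi-uniform meshes in three dimensions. -/
theorem exists_sq_apply_le_gradInner {Ω : Set E3} (hΩ : Convex ℝ Ω) {ι : Type*}
    {T : ι → Triangulation} {h : ι → ℝ} (h_pos : ∀ i, 0 < h i) (hT_sub : ∀ i, (T i).domain ⊆ Ω)
    (hT_shape : ShapeRegular T) (hT_quasi : QuasiUniform T h) :
    ∃ C : ℝ, 0 < C ∧ ∀ i, ∀ v ∈ (T i).Vh0, ∀ z, v z ^ 2 ≤ C * (h i)⁻¹ * gradInner Ω v v := by
  obtain ⟨γ, hγ, hball⟩ := hT_shape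
  obtain ⟨c₁, _, hc₁, _, hdiam⟩ := hT_quasi
  have hb := Triangulation.volume_real_ball_zero_one_pos
  set b := volume.real (Metric.ball (0 : E3) 1)
  -- With `r = γ * d` both terms of the cell estimate scale like `d⁻¹`, and `d ≥ c₁ * h i`.
  refine ⟨2 * ((b + 1) ^ 2 / γ + b / γ ^ 3) / (c₁ * b ^ 2), by positivity, fun i v hv z => ?_⟩
  have hi := h_pos i
  obtain ⟨K, hK⟩ := Triangulation.exists_lipschitzWith_of_mem_Vh0 hv
  rw [gradInner_self_eq hΩ fun x hx => hv.2.2 x fun h => hx (hT_sub i h)]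
  have hD : 0 ≤ ∫ x, ‖fderiv ℝ v x‖ ^ 2 := integral_nonneg fun _ => by positivity
  by_cases hz : z ∈ (T i).domain
  swap
  · rw [hv.2.2 z hz, zero_pow two_ne_zero]
    positivity
  obtain ⟨τ, hτ, hzτ⟩ := Triangulation.exists_mem_cell_of_mem_domain hz
  obtain ⟨a, ha⟩ := hv.2.1 τ hτ
  obtain ⟨c, hc⟩ := hball i τ hτ
  have hd := (hdiam i τ hτ).1
  set d := Metric.diam (convexHull ℝ (τ : Set E3))
  have hdpos : 0 < d := lt_of_lt_of_le (by positivity) hd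
  rw [← div_le_iff₀' (by positivity)]
  -- The energy may vanish while the cell estimate needs `S > 0`: use `S = √s` for every `s` above
  -- the energy.
  refine le_of_forall_gt_imp_ge_of_dense fun s hs => ?_
  have hspos : 0 < s := hD.trans_lt hs
  rw [div_le_iff₀' (by positivity)]
  have key := Triangulation.sq_apply_le_of_mem_cell hK
    (Triangulation.hasCompactSupport_of_mem_Vh0 hv) ha (mul_pos hγ hdpos) (Real.sqrt_pos.2 hspos) hc
    (by rw [Real.sq_sqrt hspos.le]; exact hs.le) hzτ
  change (v z * b) ^ 2 ≤ 2 * √s ^ 2 * ((b + 1) ^ 2 / (γ * d) + b * d ^ 2 / (γ * d) ^ 3) at key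
  rw [Real.sq_sqrt hspos.le, mul_pow, ← le_div_iff₀ (by positivity)] at key
  refine key.trans ?_
  calc _ = 2 * ((b + 1) ^ 2 / γ + b / γ ^ 3) / b ^ 2 * s * d⁻¹ := by field_simp
    _ ≤ 2 * ((b + 1) ^ 2 / γ + b / γ ^ 3) / b ^ 2 * s * (c₁ * h i)⁻¹ := by gcongr
    _ = _ := by field_simp

theorem mainTheorem3 (Ω : Set E3) (hΩ_open : IsOpen Ω) (hΩ_nonempty : Ω.Nonempty)
    (hΩ_convex : Convex ℝ Ω) (hΩ_bounded : Bornology.IsBounded Ω)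
    {ι : Type*} (T : ι → Triangulation) (h : ι → ℝ)
    (h_pos : ∀ i, 0 < h i) (h_lt_one : ∀ i, h i < 1)
    (hT_sub : ∀ i, (T i).domain ⊆ Ω)
    (hT_shape : ShapeRegular T) (hT_quasi : QuasiUniform T h) :
    ∃ C : ℝ, 0 < C ∧ ∀ i, ∀ z ∈ Ω,
      (∃! G : E3 → ℝ, IsDiscreteGreen Ω (T i) z G) ∧
      ∀ G : E3 → ℝ, IsDiscreteGreen Ω (T i) z G → G z ≤ C * (h i)⁻¹ := by
  obtain ⟨C, hC, hbound⟩ := exists_sq_apply_le_gradInner hΩ_convex h_pos hT_sub hT_shape hT_quasi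
  refine ⟨C, hC, fun i z _ => ⟨(T i).existsUnique_isDiscreteGreen hΩ_bounded ?_ z, ?_⟩⟩
  · intro v hv h0
    ext x
    have := hbound i v hv x
    rw [h0, mul_zero] at this
    exact pow_eq_zero_iff two_ne_zero |>.1 (this.antisymm (sq_nonneg _))
  · intro G hG
    have hi := h_pos i
    have h1 := hbound i G hG.1 z
    rw [hG.2 G hG.1, sq] at h1
    -- Cancelling a factor `G z` requires it to be positive; otherwise the bound is trivial.
    rcases le_or_gt (G z) 0 with h0 | h0
    · exact h0.trans (by positivity)
    · exact le_of_mul_le_mul_right h1 h0
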